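/- Let $k$, $m$, $N$ be positive integers with $m$ square-free, and put $\Gamma=\Gamma_0(mN)$. Let $J_{k,m}(\Gamma)$ be the space of Jacobi forms of weight $k$ and index $m$ for $\Gamma\ltimes\mathbb Z^2$ with trivial character, that is, of holomorphic functions $\phi:\mathbb H\times\mathbb C\to\mathbb C$ such that (i) $\phi|_{k,m}\gamma=\phi$ for all $\gamma\in\Gamma$, where for $\gamma=\begin{pmatrix}a&b\\c&d\end{pmatrix}\in SL_2(\mathbb Z)$ $$(\phi|_{k,m}\gamma)(\tau,z)=(c\tau+d)^{-k}e^{-2\pi i m\frac{cz^2}{c\tau+d}}\,\phi\Big(\frac{a\tau+b}{c\tau+d},\frac z{c\tau+d}\Big);$$ (ii) $\phi(\tau,z+\lambda\tau+\mu)=e^{-2\pi i m(\lambda^2\tau+2\lambda z)}\phi(\tau,z)$ for all $\lambda,\mu\in\mathbb Z$; (iii) for every $\gamma\in SL_2(\mathbb Z)$ the function $\phi|_{k,m}\gamma$ has a Fourier expansion $\sum c(n,r)e^{2\pi i(n\tau+rz)}$ over $n\in\frac1{mN}\mathbb Z$, $r\in\mathbb Z$, with $c(n,r)=0$ unless $4mn\ge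 r^2$. Every $\phi\in J_{k,m}(\Gamma)$ can be written uniquely as $\phi(\tau,z)=\sum_{r=0}^{2m-1}h_{m,r}(\tau)\theta^J_{m,r}(\tau,z)$ with $$\theta^J_{m,r}(\tau,z)=\sum_{n\in\mathbb Z}e^{2\pi i m\left((n+\frac r{2m})^2\tau+2(n+\frac r{2m})z\right)}.$$ Let $J^*_{k,m}(\Gamma)\subseteq J_{k,m}(\Gamma)$ be the subspace of those $\phi$ with $h_{m,r}=0$ for all $r\ne 0,m$. Put $$(D_0\phi)(\tau)=\phi(\tau,0),\qquad (D_2\phi)(\tau)=\Big(\frac{k}{2\pi i}\frac{\partial^2\phi}{\partial z^2}-2m\frac{\partial\phi}{\partial\tau}\Big)(\tau,0).$$ Then $\phi\mapsto(D_0\phi,D_2\phi)$ is a well-defined injective linear map $$D_0\oplus D_2:\;J^*_{k,m}(\Gamma_0(mN))\longrightarrow M_k(\Gamma_0(mN))\oplus S_{k+2}(\Gamma_0(mN)),$$ where $M_k$ and $S_{k+2}$ denote the spaces of modular forms of weight $k$ and of cusp forms of weight $k+2$ with trivial character. -/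

import Mathlib

open UpperHalfPlane
open scoped MatrixGroups

noncomputable section

/-- The weight `k`, index `m` action of `γ = (a b; c d) ∈ SL₂(ℤ)` on functions on `ℍ × ℂ`:
`(φ|γ)(τ, z) = (cτ+d)^(-k) e^(-2πi m c z² / (cτ+d)) φ((aτ+b)/(cτ+d), z/(cτ+d))`. -/
def jacobiSlash (k : ℤ) (m : ℕ) (γ : SL(2, ℤ)) (φ : ℍ → ℂ → ℂ) (τ : ℍ) (z : ℂ) : ℂ :=
  denom γ τ ^ (-k) *
    Complex.exp (-(2 * Real.pi * Complex.I * m * ((γ 1 0 : ℤ) : ℂ) * z ^ 2 / denom γ τ)) *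
    φ (γ • τ) (z / denom γ τ)

/-- Jacobi forms of weight `k` and index `m` for the Jacobi group `Γ₀(M) ⋉ ℤ²` (with trivial
character). Since `Γ₀(M)` contains the principal congruence subgroup of level `M`, the Fourier
expansion at every cusp is in powers of `e^(2πiτ/M)`, and the exponent of
`e^(2πiτ)` is the rational number `n / M`. -/
structure IsJacobiForm (k : ℤ) (m M : ℕ) (φ : ℍ → ℂ → ℂ) : Prop where
  /-- `φ` is holomorphic on `ℍ × ℂ`. -/
  holo : DifferentiableOn ℂ (fun p : ℂ × ℂ => φ (ofComplex p.1) p.2) {p | 0 < p.1.im}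
  /-- invariance under `Γ₀(M)` -/
  slash : ∀ γ ∈ CongruenceSubgroup.Gamma0 M, ∀ τ z, jacobiSlash k m γ φ τ z = φ τ z
  /-- invariance under the lattice translations `z ↦ z + λτ + μ` -/
  elliptic : ∀ (l μ : ℤ) (τ : ℍ) (z : ℂ),
    φ τ (z + l * τ + μ) =
      Complex.exp (-(2 * Real.pi * Complex.I * m * (l ^ 2 * τ + 2 * l * z))) * φ τ z
  /-- For every `γ ∈ SL₂(ℤ)` one has
  `φ|γ = ∑ c(n, r) e^(2πi (n/M) τ) e^(2πi r z)` with `c(n, r) = 0` unless `4m(n/M) ≥ r²`. -/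
  fourier : ∀ γ : SL(2, ℤ), ∃ c : ℤ × ℤ → ℂ,
    (∀ n r : ℤ, 4 * m * n < M * r ^ 2 → c (n, r) = 0) ∧
    ∀ (τ : ℍ) (z : ℂ), HasSum
      (fun p : ℤ × ℤ => c p *
        Complex.exp (2 * Real.pi * Complex.I * ((p.1 : ℂ) / M * τ + p.2 * z)))
      (jacobiSlash k m γ φ τ z)

/-- The theta series
`θ^J_{m,r}(τ, z) = ∑_{n ∈ ℤ} e^(2πi m ((n + r/2m)² τ + 2 (n + r/2m) z))`. -/
def thetaJ (m r : ℕ) (τ : ℍ) (z : ℂ) : ℂ :=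
  ∑' n : ℤ, Complex.exp (2 * Real.pi * Complex.I * m *
    (((n : ℂ) + r / (2 * m)) ^ 2 * τ + 2 * ((n : ℂ) + r / (2 * m)) * z))

/-- `h = (h_{m,r})_{0 ≤ r < 2m}` is the family of coefficients of the theta decomposition
`φ(τ, z) = ∑_{0 ≤ r < 2m} h_{m,r}(τ) θ^J_{m,r}(τ, z)`. Every Jacobi form of index `m` has exactly
one such family. -/
def IsThetaDecomposition (m : ℕ) (φ : ℍ → ℂ → ℂ) (h : ℕ → ℍ → ℂ) : Prop :=
  ∀ (τ : ℍ) (z : ℂ), φ τ z = ∑ r ∈ Finset.range (2 * m), h r τ * thetaJ m r τ z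

lemma jacobiSlash_add (k : ℤ) (m : ℕ) (γ : SL(2, ℤ)) (φ ψ : ℍ → ℂ → ℂ) (τ : ℍ) (z : ℂ) :
    jacobiSlash k m γ (φ + ψ) τ z = jacobiSlash k m γ φ τ z + jacobiSlash k m γ ψ τ z := by
  simp only [jacobiSlash, Pi.add_apply]; ring

lemma jacobiSlash_smul (k : ℤ) (m : ℕ) (γ : SL(2, ℤ)) (a : ℂ) (φ : ℍ → ℂ → ℂ) (τ : ℍ) (z : ℂ) :
    jacobiSlash k m γ (a • φ) τ z = a * jacobiSlash k m γ φ τ z := by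
  simp only [jacobiSlash, Pi.smul_apply, smul_eq_mul]; ring

/-- The space `J_{k,m}(Γ₀(M))` of Jacobi forms. -/
def jacobiForms (k : ℤ) (m M : ℕ) : Submodule ℂ (ℍ → ℂ → ℂ) where
  carrier := {φ | IsJacobiForm k m M φ}
  zero_mem' :=
    { holo := by simp
      slash := by simp [jacobiSlash]
      elliptic := by simp
      fourier := fun γ => ⟨0, by simp, by simp [jacobiSlash, hasSum_zero]⟩ }
  add_mem' := by
    intro φ ψ hφ hψ
    refine ⟨?_, ?_, ?_, ?_⟩
    · exact hφ.holo.add hψ.holo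
    · intro γ hγ τ z
      rw [jacobiSlash_add, hφ.slash γ hγ, hψ.slash γ hγ]; rfl
    · intro l μ τ z
      simp only [Pi.add_apply, hφ.elliptic, hψ.elliptic]; ring
    · intro γ
      obtain ⟨c, hc, hs⟩ := hφ.fourier γ
      obtain ⟨d, hd, ht⟩ := hψ.fourier γ
      refine ⟨c + d, fun n r h => by simp [hc n r h, hd n r h], fun τ z => ?_⟩
      rw [jacobiSlash_add]
      convert (hs τ z).add (ht τ z) using 2 with p
      simp only [Pi.add_apply]; ring
  smul_mem' := by
    intro a φ hφ
    refine ⟨?_, ?_, ?_, ?_⟩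
    · exact hφ.holo.const_smul a
    · intro γ hγ τ z
      rw [jacobiSlash_smul, hφ.slash γ hγ]; rfl
    · intro l μ τ z
      change a * φ τ (z + l * τ + μ) = _ * (a * φ τ z)
      rw [hφ.elliptic]; ring
    · intro γ
      obtain ⟨c, hc, hs⟩ := hφ.fourier γ
      refine ⟨a • c, fun n r h => by simp [hc n r h], fun τ z => ?_⟩
      rw [jacobiSlash_smul]
      simpa only [Pi.smul_apply, smul_eq_mul, mul_assoc] using (hs τ z).mul_left a

/-- The subspace `J*_{k,m}(Γ₀(M))` of those Jacobi forms for which `h_{m,r} = 0` for all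
`0 ≤ r < 2m` with `r ≠ 0, m`. -/
def jacobiFormsStar (k : ℤ) (m M : ℕ) : Submodule ℂ (ℍ → ℂ → ℂ) where
  carrier := {φ | φ ∈ jacobiForms k m M ∧ ∃ h : ℕ → ℍ → ℂ, IsThetaDecomposition m φ h ∧
    ∀ r < 2 * m, r ≠ 0 → r ≠ m → h r = 0}
  zero_mem' := ⟨Submodule.zero_mem _, 0, by simp [IsThetaDecomposition], by simp⟩
  add_mem' := by
    rintro φ ψ ⟨hφ, h, hd, h0⟩ ⟨hψ, g, gd, g0⟩
    refine ⟨Submodule.add_mem _ hφ hψ, h + g, fun τ z => ?_, fun r hr h1 h2 => ?_⟩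
    · simp only [Pi.add_apply, hd τ z, gd τ z, add_mul, Finset.sum_add_distrib]
    · simp [h0 r hr h1 h2, g0 r hr h1 h2]
  smul_mem' := by
    rintro a φ ⟨hφ, h, hd, h0⟩
    refine ⟨Submodule.smul_mem _ a hφ, a • h, fun τ z => ?_, fun r hr h1 h2 => ?_⟩
    · simp only [Pi.smul_apply, smul_eq_mul, hd τ z, Finset.mul_sum, mul_assoc]
    · simp [h0 r hr h1 h2]

/-- The restriction map `(D₀ φ)(τ) = φ(τ, 0)`. -/
def jacobiD0 (φ : ℍ → ℂ → ℂ) (τ : ℍ) : ℂ := φ τ 0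

/-- The differential operator `D₂ = (k/(2πi) ∂²/∂z² - 2m ∂/∂τ)|_{z=0}` on functions on `ℍ × ℂ`. -/
def jacobiD2 (k : ℤ) (m : ℕ) (φ : ℍ → ℂ → ℂ) (τ : ℍ) : ℂ :=
  k / (2 * Real.pi * Complex.I) * iteratedDeriv 2 (fun z : ℂ => φ τ z) 0 -
    2 * m * deriv (fun w : ℂ => φ (ofComplex w) 0) τ

end

/-!
In the weight `k` transformation law, `∂²/∂z²` and `∂/∂τ` each contribute a multiple of
`c/(cτ+d) φ(τ, 0)`; the coefficients of `D₂` are those for which the two cancel, so `D₀ φ` and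
`D₂ φ` are modular of weights `k` and `k + 2`. At each cusp, `4mn ≥ r²` leaves only exponents
`n ≥ 0`, and the exponent `n = 0` forces `r = 0`, where `D₂` has coefficient zero.

If `D₀ φ = 0` and `D₂ φ = 0`, then `φ(τ, 0) = 0` and `∂²φ/∂z²(τ, 0) = 0`. For `φ` in the star space
this is a homogeneous `2 × 2` linear system for `h_{m,0}(τ)` and `h_{m,m}(τ)`, whose determinant
is, up to a constant, the Wronskian of the theta constants `θ_{m,0}` and `θ_{m,m}`. High up the
imaginary axis the term `n = 0` of `θ_{m,0}` dominates and the determinant is nonzero, so `φ`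
vanishes there, and hence everywhere by the identity theorem.
-/

open Filter
open scoped Manifold ModularForm Real Topology

/-! ### Exponential series -/

section ExponentialSeries

variable {ι : Type*} {a ξ : ι → ℂ} {f : ℂ → ℂ} {U : Set ℂ} {z : ℂ}

lemma convexOn_norm_exp_mul (ξ : ℂ) : ConvexOn ℝ Set.univ fun w : ℂ => ‖Complex.exp (ξ * w)‖ := by
  simp only [Complex.norm_exp]
  exact convexOn_exp.comp_linearMap (Complex.reLm ∘ₗ LinearMap.mulLeft ℝ ξ)

lemma norm_exp_mul_le_sum_of_mem_convexHull {κ : Type*} [Fintype κ] {b : κ → ℂ} {w : ℂ}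
    (hw : w ∈ convexHull ℝ (Set.range b)) (ξ : ℂ) :
    ‖Complex.exp (ξ * w)‖ ≤ ∑ j, ‖Complex.exp (ξ * b j)‖ := by
  obtain ⟨_, ⟨j, rfl⟩, hj⟩ :=
    ((convexOn_norm_exp_mul ξ).subset (Set.subset_univ _)
      (convex_convexHull ℝ (Set.range b))).exists_ge_of_mem_convexHull
      (subset_convexHull ℝ _) hw
  exact hj.trans
    (Finset.single_le_sum (f := fun j => ‖Complex.exp (ξ * b j)‖)
      (fun _ _ => norm_nonneg _) (Finset.mem_univ j))

/-- Absolute convergence at the vertices of a triangle dominates the series on the whole triangle,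
so the Weierstrass theorem on locally uniform limits applies. -/
lemma differentiableAt_and_hasSum_deriv_of_hasSum_exp (hU : IsOpen U)
    (hf : ∀ w ∈ U, HasSum (fun i => a i * Complex.exp (ξ i * w)) (f w)) (hz : z ∈ U) :
    DifferentiableAt ℂ f z ∧
      HasSum (fun i => a i * ξ i * Complex.exp (ξ i * z)) (deriv f z) := by
  obtain ⟨b, hzb, hbU⟩ := exists_mem_interior_convexHull_affineBasis (hU.mem_nhds hz)
  have hbound : Summable fun i => ∑ j, ‖a i * Complex.exp (ξ i * b j)‖ :=
    summable_sum fun j _ =>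
      (hf (b j) (hbU (subset_convexHull ℝ _ (Set.mem_range_self j)))).summable.norm
  have hle (i : ι) (w : ℂ) (hw : w ∈ interior (convexHull ℝ (Set.range b))) :
      ‖a i * Complex.exp (ξ i * w)‖ ≤ ∑ j, ‖a i * Complex.exp (ξ i * b j)‖ := by
    simp only [norm_mul, ← Finset.mul_sum]
    gcongr
    exact norm_exp_mul_le_sum_of_mem_convexHull (interior_subset hw) _
  have hterm (i : ι) (w : ℂ) : HasDerivAt (fun w => a i * Complex.exp (ξ i * w))
      (a i * ξ i * Complex.exp (ξ i * w)) w :=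
    (((hasDerivAt_id w).const_mul (ξ i)).cexp.const_mul (a i)).congr_deriv
      (by simp only [id]; ring)
  have hdiff (i : ι) : DifferentiableOn ℂ (fun w => a i * Complex.exp (ξ i * w))
      (interior (convexHull ℝ (Set.range b))) :=
    fun w _ => (hterm i w).differentiableAt.differentiableWithinAt
  have heq : f =ᶠ[𝓝 z] fun w => ∑' i, a i * Complex.exp (ξ i * w) := by
    filter_upwards [hU.mem_nhds hz] with w hw using (hf w hw).tsum_eq.symm
  refine ⟨heq.differentiableAt_iff.2 <| (Complex.differentiableOn_tsum_of_summable_norm hbound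
    hdiff isOpen_interior hle).differentiableAt (isOpen_interior.mem_nhds hzb), ?_⟩
  simpa only [heq.deriv_eq, (hterm _ z).deriv] using
    Complex.hasSum_deriv_of_summable_norm hbound hdiff isOpen_interior hle hzb

lemma hasSum_iteratedDeriv_of_hasSum_exp (hU : IsOpen U)
    (hf : ∀ w ∈ U, HasSum (fun i => a i * Complex.exp (ξ i * w)) (f w)) (n : ℕ) :
    ∀ z ∈ U, HasSum (fun i => a i * ξ i ^ n * Complex.exp (ξ i * z)) (iteratedDeriv n f z) := by
  induction n with
  | zero => simpa using hf
  | succ n ih =>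
    intro z hz
    simpa only [iteratedDeriv_succ, pow_succ, mul_assoc] using
      (differentiableAt_and_hasSum_deriv_of_hasSum_exp hU ih hz).2

end ExponentialSeries

/-! ### Fourier series on the upper half-plane -/

section FourierSeries

open Derivative

variable {ι : Type*} {a : ι → ℂ} {x : ι → ℝ} {f : ℍ → ℂ}

lemma hasSum_comp_ofComplex
    (hf : ∀ τ : ℍ, HasSum (fun i => a i * Complex.exp (2 * π * Complex.I * x i * τ)) (f τ)) :
    ∀ w ∈ upperHalfPlaneSet,
      HasSum (fun i => a i * Complex.exp (2 * π * Complex.I * x i * w)) ((f ∘ ofComplex) w) := by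
  intro w hw
  simpa [ofComplex_apply_of_im_pos hw] using hf ⟨w, hw⟩

lemma mdifferentiable_of_hasSum_exp
    (hf : ∀ τ : ℍ, HasSum (fun i => a i * Complex.exp (2 * π * Complex.I * x i * τ)) (f τ)) :
    MDiff f :=
  mdifferentiable_iff.2 fun _ hw => (differentiableAt_and_hasSum_deriv_of_hasSum_exp
    isOpen_upperHalfPlaneSet (hasSum_comp_ofComplex hf) hw).1.differentiableWithinAt

lemma hasSum_normalizedDeriv_of_hasSum_exp
    (hf : ∀ τ : ℍ, HasSum (fun i => a i * Complex.exp (2 * π * Complex.I * x i * τ)) (f τ))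
    (τ : ℍ) :
    HasSum (fun i => a i * x i * Complex.exp (2 * π * Complex.I * x i * τ)) (D f τ) := by
  refine ((differentiableAt_and_hasSum_deriv_of_hasSum_exp isOpen_upperHalfPlaneSet
    (hasSum_comp_ofComplex hf) τ.im_pos).2.mul_left (2 * π * Complex.I)⁻¹).congr_fun fun i => ?_
  field_simp

lemma norm_exp_two_pi_I_mul (x : ℝ) (τ : ℍ) :
    ‖Complex.exp (2 * π * Complex.I * x * τ)‖ = Real.exp (-(2 * π * x) * τ.im) := by
  simp [Complex.norm_exp]

lemma norm_exp_two_pi_I_mul_le {x : ℝ} (hx : 0 ≤ x) {σ τ : ℍ} (h : σ.im ≤ τ.im) :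
    ‖Complex.exp (2 * π * Complex.I * x * τ)‖ ≤ ‖Complex.exp (2 * π * Complex.I * x * σ)‖ := by
  simp only [norm_exp_two_pi_I_mul, neg_mul]
  gcongr

lemma isBoundedAtImInfty_of_hasSum_exp
    (hf : ∀ τ : ℍ, HasSum (fun i => a i * Complex.exp (2 * π * Complex.I * x i * τ)) (f τ))
    (hx : ∀ i, a i ≠ 0 → 0 ≤ x i) : IsBoundedAtImInfty f := by
  refine isBoundedAtImInfty_iff.2
    ⟨_, UpperHalfPlane.I.im, fun τ hτ => (hf τ).tsum_eq ▸
      tsum_of_norm_bounded (hf UpperHalfPlane.I).summable.norm.hasSum fun i => ?_⟩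
  rcases eq_or_ne (a i) 0 with hi | hi
  · simp [hi]
  · simpa only [norm_mul] using
      mul_le_mul_of_nonneg_left (norm_exp_two_pi_I_mul_le (hx i hi) hτ) (norm_nonneg _)

lemma tendsto_exp_two_pi_I_mul_atImInfty {x : ℝ} (hx : 0 < x) :
    Tendsto (fun τ : ℍ => Complex.exp (2 * π * Complex.I * x * τ)) atImInfty (𝓝 0) := by
  rw [tendsto_zero_iff_norm_tendsto_zero]
  simp only [norm_exp_two_pi_I_mul]
  exact Real.tendsto_exp_atBot.comp
    (tendsto_comap.const_mul_atTop_of_neg (neg_lt_zero.2 (by positivity)))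

lemma isZeroAtImInfty_of_hasSum_exp
    (hf : ∀ τ : ℍ, HasSum (fun i => a i * Complex.exp (2 * π * Complex.I * x i * τ)) (f τ))
    (hx : ∀ i, a i ≠ 0 → 0 < x i) : IsZeroAtImInfty f := by
  have hlim : Tendsto (fun τ : ℍ => ∑' i, a i * Complex.exp (2 * π * Complex.I * x i * τ))
      atImInfty (𝓝 (∑' _ : ι, 0)) := by
    refine tendsto_tsum_of_dominated_convergence (hf UpperHalfPlane.I).summable.norm
      (fun i => ?_) ?_
    · rcases eq_or_ne (a i) 0 with hi | hi
      · simp [hi]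
      · simpa using (tendsto_exp_two_pi_I_mul_atImInfty (hx i hi)).const_mul (a i)
    · filter_upwards [tendsto_comap.eventually_ge_atTop UpperHalfPlane.I.im] with τ hτ i
      rcases eq_or_ne (a i) 0 with hi | hi
      · simp [hi]
      · simpa only [norm_mul] using
          mul_le_mul_of_nonneg_left (norm_exp_two_pi_I_mul_le (hx i hi).le hτ) (norm_nonneg _)
  simpa only [IsZeroAtImInfty, ZeroAtFilter, (hf _).tsum_eq, tsum_zero] using hlim

end FourierSeries

/-! ### Transformation of `D₀` and `D₂` -/

section Slash

open Derivative

variable {k : ℤ} {m M : ℕ} {φ ψ : ℍ → ℂ → ℂ}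

lemma jacobiD2_apply (k : ℤ) (m : ℕ) (φ : ℍ → ℂ → ℂ) (τ : ℍ) :
    jacobiD2 k m φ τ = k / (2 * π * Complex.I) * iteratedDeriv 2 (φ τ) 0 -
      2 * m * (2 * π * Complex.I * D (jacobiD0 φ) τ) := by
  rw [normalizedDerivOfComplex, mul_inv_cancel_left₀ Complex.two_pi_I_ne_zero]
  rfl

lemma jacobiD0_jacobiSlash (k : ℤ) (m : ℕ) (γ : SL(2, ℤ)) (φ : ℍ → ℂ → ℂ) :
    jacobiD0 (jacobiSlash k m γ φ) = jacobiD0 φ ∣[k] γ := by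
  funext τ
  simp [jacobiD0, jacobiSlash, ModularForm.SL_slash_apply, mul_comm]

lemma hasDerivAt_exp_neg_mul_sq (A z : ℂ) :
    HasDerivAt (fun z => Complex.exp (-(A * z ^ 2)))
      (Complex.exp (-(A * z ^ 2)) * -(A * (2 * z))) z := by
  simpa using (((hasDerivAt_id z).pow 2).const_mul A).neg.cexp

lemma iteratedDeriv_two_exp_neg_mul_sq (A : ℂ) :
    iteratedDeriv 2 (fun z => Complex.exp (-(A * z ^ 2))) 0 = -(2 * A) := by
  rw [iteratedDeriv_succ, iteratedDeriv_one, funext fun z => (hasDerivAt_exp_neg_mul_sq A z).deriv]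
  refine ((hasDerivAt_exp_neg_mul_sq A 0).mul
    (((hasDerivAt_id' (0 : ℂ)).const_mul 2).const_mul A).fun_neg).deriv.trans ?_
  simp
  ring

lemma iteratedDeriv_two_exp_neg_mul_sq_mul_comp_div {g : ℂ → ℂ} (hg : Differentiable ℂ g)
    (A d : ℂ) :
    iteratedDeriv 2 (fun z => Complex.exp (-(A * z ^ 2)) * g (z / d)) 0 =
      iteratedDeriv 2 g 0 / d ^ 2 - 2 * A * g 0 := by
  have hexp : ContDiff ℂ 2 fun z : ℂ => Complex.exp (-(A * z ^ 2)) := by fun_prop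
  have hgd : ContDiff ℂ 2 fun z => g (d⁻¹ * z) := hg.contDiff.comp (by fun_prop)
  have hexp0 : deriv (fun z : ℂ => Complex.exp (-(A * z ^ 2))) 0 = 0 := by
    simpa using (hasDerivAt_exp_neg_mul_sq A 0).deriv
  simp only [div_eq_inv_mul]
  rw [iteratedDeriv_fun_mul hexp.contDiffAt hgd.contDiffAt]
  simp [Finset.sum_range_succ, iteratedDeriv_two_exp_neg_mul_sq, hexp0,
    iteratedDeriv_comp_const_mul hg.contDiff]
  ring

lemma iteratedDeriv_two_jacobiSlash (hφ : ∀ τ, Differentiable ℂ (φ τ)) (k : ℤ) (m : ℕ)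
    (γ : SL(2, ℤ)) (τ : ℍ) :
    iteratedDeriv 2 (jacobiSlash k m γ φ τ) 0 = denom γ τ ^ (-k) *
      (iteratedDeriv 2 (φ (γ • τ)) 0 / denom γ τ ^ 2 -
        2 * (2 * π * Complex.I * m * (γ 1 0 : ℤ) / denom γ τ) * jacobiD0 φ (γ • τ)) := by
  rw [jacobiD0, ← iteratedDeriv_two_exp_neg_mul_sq_mul_comp_div (hφ _),
    ← iteratedDeriv_const_mul_field]
  congr 1
  funext z
  simp only [jacobiSlash, mul_assoc, mul_div_right_comm]

/-- `k/(2πi) ∂²/∂z²` and `2m ∂/∂τ` produce the same extra term `-2mk c/(cτ+d) φ`. -/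
lemma jacobiD2_jacobiSlash (hφ : ∀ τ, Differentiable ℂ (φ τ)) (hφ₀ : MDiff (jacobiD0 φ))
    (γ : SL(2, ℤ)) : jacobiD2 k m (jacobiSlash k m γ φ) = jacobiD2 k m φ ∣[k + 2] γ := by
  funext τ
  have hd : denom γ τ ≠ 0 := denom_ne_zero _ τ
  have hdk : denom γ τ ^ (-(k + 2)) = denom γ τ ^ (-k) / denom γ τ ^ 2 := by
    rw [neg_add, ← sub_eq_add_neg, zpow_sub₀ hd]
    norm_cast
  have hD : D (jacobiD0 φ ∣[k] γ) τ = denom γ τ ^ (-k) * (D (jacobiD0 φ) (γ • τ) / denom γ τ ^ 2 -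
      k * (2 * π * Complex.I)⁻¹ * ((γ 1 0 : ℤ) / denom γ τ) * jacobiD0 φ (γ • τ)) := by
    simp only [normalizedDerivOfComplex_SL_slash hφ₀, Pi.sub_apply, ModularForm.SL_slash_apply, hdk]
    ring
  rw [jacobiD2_apply, iteratedDeriv_two_jacobiSlash hφ, jacobiD0_jacobiSlash, hD,
    ModularForm.SL_slash_apply, jacobiD2_apply, hdk]
  field_simp
  ring

lemma jacobiD2_add (hφ : ∀ τ, Differentiable ℂ (φ τ)) (hψ : ∀ τ, Differentiable ℂ (ψ τ))
    (hφ₀ : MDiff (jacobiD0 φ)) (hψ₀ : MDiff (jacobiD0 ψ)) :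
    jacobiD2 k m (φ + ψ) = jacobiD2 k m φ + jacobiD2 k m ψ := by
  funext τ
  have hD₀ : jacobiD0 (φ + ψ) = jacobiD0 φ + jacobiD0 ψ := rfl
  simp only [jacobiD2_apply, Pi.add_apply, hD₀, normalizedDerivOfComplex_add _ _ hφ₀ hψ₀,
    iteratedDeriv_add (hφ τ).contDiff.contDiffAt (hψ τ).contDiff.contDiffAt]
  ring

lemma jacobiD2_smul (a : ℂ) (φ : ℍ → ℂ → ℂ) : jacobiD2 k m (a • φ) = a • jacobiD2 k m φ := by
  funext τ
  simp only [jacobiD2, Pi.smul_apply, smul_eq_mul, iteratedDeriv_const_mul_field,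
    deriv_const_mul_field]
  ring

end Slash

/-! ### Fourier expansions of `D₀` and `D₂` -/

/-- `ψ` has the Fourier expansion `∑ c(n, r) e^(2πi (n/M) τ) e^(2πi r z)`, supported on the pairs
`(n, r)` with `4m(n/M) ≥ r²`. -/
structure HasJacobiExpansion (m M : ℕ) (ψ : ℍ → ℂ → ℂ) (c : ℤ × ℤ → ℂ) : Prop where
  support : ∀ n r : ℤ, 4 * m * n < M * r ^ 2 → c (n, r) = 0
  hasSum : ∀ (τ : ℍ) (z : ℂ), HasSum
    (fun p : ℤ × ℤ => c p *
      Complex.exp (2 * π * Complex.I * ((p.1 : ℂ) / M * τ + p.2 * z))) (ψ τ z)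

namespace HasJacobiExpansion

variable {m M : ℕ} {ψ : ℍ → ℂ → ℂ} {c : ℤ × ℤ → ℂ}

lemma hasSum_mul_exp (h : HasJacobiExpansion m M ψ c) (τ : ℍ) (z : ℂ) :
    HasSum (fun p : ℤ × ℤ => c p * Complex.exp (2 * π * Complex.I * (p.1 / M : ℝ) * τ) *
      Complex.exp (2 * π * Complex.I * p.2 * z)) (ψ τ z) := by
  refine (h.hasSum τ z).congr_fun fun p => ?_
  rw [mul_assoc, ← Complex.exp_add]
  push_cast
  ring_nf

lemma hasSum_jacobiD0 (h : HasJacobiExpansion m M ψ c) (τ : ℍ) :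
    HasSum (fun p : ℤ × ℤ => c p * Complex.exp (2 * π * Complex.I * (p.1 / M : ℝ) * τ))
      (jacobiD0 ψ τ) := by
  simpa only [jacobiD0, mul_zero, Complex.exp_zero, mul_one] using h.hasSum_mul_exp τ 0

lemma hasSum_jacobiD2 (h : HasJacobiExpansion m M ψ c) (k : ℤ) (τ : ℍ) :
    HasSum (fun p : ℤ × ℤ => c p * (2 * π * Complex.I * (k * p.2 ^ 2 - 2 * m * (p.1 / M : ℝ))) *
      Complex.exp (2 * π * Complex.I * (p.1 / M : ℝ) * τ)) (jacobiD2 k m ψ τ) := by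
  have hz := hasSum_iteratedDeriv_of_hasSum_exp isOpen_univ
    (fun z _ => h.hasSum_mul_exp τ z) 2 0 (Set.mem_univ _)
  have hτ := hasSum_normalizedDeriv_of_hasSum_exp h.hasSum_jacobiD0 τ
  rw [jacobiD2_apply]
  refine ((hz.mul_left _).sub ((hτ.mul_left _).mul_left _)).congr_fun fun p => ?_
  rw [mul_zero, Complex.exp_zero]
  field_simp

lemma mdifferentiable_jacobiD2 (h : HasJacobiExpansion m M ψ c) (k : ℤ) :
    MDiff (jacobiD2 k m ψ) :=
  mdifferentiable_of_hasSum_exp (h.hasSum_jacobiD2 k)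

lemma sq_le_of_ne_zero (h : HasJacobiExpansion m M ψ c) (hM : 0 < M) {p : ℤ × ℤ} (hp : c p ≠ 0) :
    (p.2 : ℝ) ^ 2 ≤ 4 * m * (p.1 / M) := by
  have hM' : (0 : ℝ) < M := Nat.cast_pos.2 hM
  rw [← mul_div_assoc, le_div_iff₀' hM']
  exact_mod_cast not_lt.1 (mt (h.support p.1 p.2) hp)

lemma isBoundedAtImInfty_jacobiD0 (h : HasJacobiExpansion m M ψ c) (hm : 0 < m) (hM : 0 < M) :
    IsBoundedAtImInfty (jacobiD0 ψ) :=
  isBoundedAtImInfty_of_hasSum_exp h.hasSum_jacobiD0 fun p hp =>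
    nonneg_of_mul_nonneg_right ((sq_nonneg _).trans (h.sq_le_of_ne_zero hM hp)) (by positivity)

/-- An index `(0, r)` in the support has `r = 0`, and there `k r² - 2m n/M` vanishes. -/
lemma isZeroAtImInfty_jacobiD2 (h : HasJacobiExpansion m M ψ c) (k : ℤ) (hm : 0 < m)
    (hM : 0 < M) : IsZeroAtImInfty (jacobiD2 k m ψ) := by
  refine isZeroAtImInfty_of_hasSum_exp (h.hasSum_jacobiD2 k) fun p hp => ?_
  have hsq := h.sq_le_of_ne_zero hM (left_ne_zero_of_mul hp)
  by_contra! hx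
  have hx₀ : (p.1 / M : ℝ) = 0 :=
    hx.antisymm (nonneg_of_mul_nonneg_right ((sq_nonneg _).trans hsq) (by positivity))
  have hr₀ : (p.2 : ℝ) = 0 := pow_eq_zero_iff two_ne_zero |>.1 <|
    (hsq.trans_eq (by rw [hx₀, mul_zero])).antisymm (sq_nonneg _)
  refine hp ?_
  rw [hx₀, Int.cast_eq_zero.1 hr₀]
  simp

end HasJacobiExpansion

/-! ### Theta constants on the imaginary axis -/

section ThetaMoment

/-- The theta constant `∑ v^(2j) e^(-πv²t)` over `v ∈ a + ℤ`. -/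
noncomputable def thetaMoment (a : ℝ) (j : ℕ) (t : ℝ) : ℝ :=
  ∑' n : ℤ, (n + a) ^ (2 * j) * Real.exp (-π * (n + a) ^ 2 * t)

variable {a t : ℝ}

/-- `u^j ≤ j! e^u` for `u = πv²t/2` reduces this to the case `j = 0` at `t/2`. -/
lemma summable_thetaMoment (a : ℝ) (j : ℕ) (ht : 0 < t) :
    Summable fun n : ℤ => (n + a) ^ (2 * j) * Real.exp (-π * (n + a) ^ 2 * t) := by
  have hs := (HurwitzZeta.hasSum_int_evenKernel a (half_pos ht)).summable.mul_left
    (j.factorial / (π * t / 2) ^ j)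
  refine hs.of_nonneg_of_le (fun n => by rw [pow_mul]; positivity) fun n => ?_
  have hexp := Real.pow_div_factorial_le_exp (π * (n + a) ^ 2 * (t / 2)) (by positivity) j
  rw [div_le_iff₀ (by positivity)] at hexp
  calc (n + a) ^ (2 * j) * Real.exp (-π * (n + a) ^ 2 * t)
      = (π * (n + a) ^ 2 * (t / 2)) ^ j / (π * t / 2) ^ j *
          Real.exp (-π * (n + a) ^ 2 * t) := by
        rw [← div_pow, pow_mul]
        congr 2
        field_simp
    _ ≤ Real.exp (π * (n + a) ^ 2 * (t / 2)) * j.factorial / (π * t / 2) ^ j *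
          Real.exp (-π * (n + a) ^ 2 * t) := by gcongr
    _ = j.factorial / (π * t / 2) ^ j * Real.exp (-π * (n + a) ^ 2 * (t / 2)) := by
        rw [show -π * (n + a) ^ 2 * (t / 2) =
          π * (n + a) ^ 2 * (t / 2) + -π * (n + a) ^ 2 * t by ring, Real.exp_add]
        ring

lemma one_le_thetaMoment_zero (ht : 0 < t) : 1 ≤ thetaMoment 0 0 t := by
  simpa [thetaMoment] using
    (summable_thetaMoment 0 0 ht).le_tsum 0 fun n _ => by rw [pow_mul]; positivity

lemma thetaMoment_zero_right_pos (a : ℝ) (ht : 0 < t) : 0 < thetaMoment a 0 t :=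
  (summable_thetaMoment a 0 ht).tsum_pos (fun n => by rw [pow_mul]; positivity) 0
    (by simp [Real.exp_pos])

lemma one_fourth_le_int_add_half_sq (n : ℤ) : 1 / 4 ≤ ((n : ℝ) + 1 / 2) ^ 2 := by
  have hn : (0 : ℝ) ≤ n * (n + 1) := by
    exact_mod_cast (by rcases le_or_gt 0 n with h | h <;> nlinarith : 0 ≤ n * (n + 1))
  linarith

lemma thetaMoment_half_zero_le (ht : 0 < t) :
    thetaMoment (1 / 2) 0 t ≤ 4 * thetaMoment (1 / 2) 1 t := by
  rw [thetaMoment, thetaMoment, ← tsum_mul_left]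
  refine (summable_thetaMoment _ 0 ht).tsum_le_tsum (fun n => ?_)
    ((summable_thetaMoment _ 1 ht).mul_left 4)
  rw [← mul_assoc, mul_zero, pow_zero, mul_one 2]
  gcongr
  linarith [one_fourth_le_int_add_half_sq n]

lemma tendsto_thetaMoment_zero {j : ℕ} (hj : j ≠ 0) :
    Tendsto (thetaMoment 0 j) atTop (𝓝 0) := by
  suffices Tendsto (thetaMoment 0 j) atTop (𝓝 (∑' _ : ℤ, 0)) by simpa only [tsum_zero] using this
  refine tendsto_tsum_of_dominated_convergence (summable_thetaMoment 0 j one_pos) (fun n => ?_) ?_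
  · rcases eq_or_ne n 0 with rfl | hn
    · simp [hj]
    · have hn' : (n : ℝ) + 0 ≠ 0 := by simpa using hn
      have hexp : Tendsto (fun t => Real.exp (-π * (n + 0) ^ 2 * t)) atTop (𝓝 0) :=
        Real.tendsto_exp_atBot.comp <| tendsto_id.const_mul_atTop_of_neg <| by
          rw [neg_mul, neg_lt_zero]
          positivity
      simpa using hexp.const_mul _
  · filter_upwards [eventually_ge_atTop 1] with t ht n
    have hle : -π * ((n : ℝ) + 0) ^ 2 * t ≤ -π * (n + 0) ^ 2 * 1 :=
      mul_le_mul_of_nonpos_left ht (by rw [neg_mul, neg_nonpos]; positivity)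
    rw [Real.norm_of_nonneg (by rw [pow_mul]; positivity), pow_mul]
    exact mul_le_mul_of_nonneg_left (Real.exp_le_exp.2 hle) (by positivity)

lemma eventually_thetaMoment_det_pos : ∀ᶠ t in atTop,
    0 < thetaMoment 0 0 t * thetaMoment (1 / 2) 1 t -
      thetaMoment (1 / 2) 0 t * thetaMoment 0 1 t := by
  filter_upwards [(tendsto_thetaMoment_zero one_ne_zero).eventually_lt_const
    (by norm_num : (0 : ℝ) < 1 / 4), eventually_gt_atTop 0] with t hlt ht
  have hone := one_le_thetaMoment_zero ht
  have hpos := thetaMoment_zero_right_pos (1 / 2) ht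
  have hle := thetaMoment_half_zero_le ht
  nlinarith

end ThetaMoment

section Theta

variable {m : ℕ}

lemma hasSum_thetaJ (hm : 0 < m) (r : ℕ) (τ : ℍ) (z : ℂ) :
    HasSum (fun n : ℤ => Complex.exp (2 * π * Complex.I * m * ((n : ℂ) + r / (2 * m)) ^ 2 * τ) *
      Complex.exp (4 * π * Complex.I * m * (n + r / (2 * m)) * z)) (thetaJ m r τ z) := by
  have hm' : (m : ℂ) ≠ 0 := Nat.cast_ne_zero.2 hm.ne'
  have him : 0 < (2 * m * (τ : ℂ)).im := by
    simpa [hm] using τ.im_pos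
  have hterm (n : ℤ) : Complex.exp (2 * π * Complex.I * m * ((n : ℂ) + r / (2 * m)) ^ 2 * τ) *
      Complex.exp (4 * π * Complex.I * m * (n + r / (2 * m)) * z) =
      Complex.exp (2 * π * Complex.I * (r ^ 2 / (4 * m) * τ + r * z)) *
        jacobiTheta₂_term n (2 * m * z + r * τ) (2 * m * τ) := by
    rw [jacobiTheta₂_term, ← Complex.exp_add, ← Complex.exp_add]
    congr 1
    field_simp
    ring
  have hsum := (((summable_jacobiTheta₂_term_iff (2 * m * z + r * τ) _).2 him).mul_left
    (Complex.exp (2 * π * Complex.I * (r ^ 2 / (4 * m) * τ + r * z)))).congr fun n => (hterm n).symm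
  refine hsum.hasSum_iff.2 (tsum_congr fun n => ?_)
  rw [← Complex.exp_add]
  ring_nf

lemma differentiable_thetaJ (hm : 0 < m) (r : ℕ) (τ : ℍ) : Differentiable ℂ (thetaJ m r τ) :=
  fun _ => (differentiableAt_and_hasSum_deriv_of_hasSum_exp isOpen_univ
    (fun z _ => hasSum_thetaJ hm r τ z) (Set.mem_univ _)).1

lemma iteratedDeriv_thetaJ_zero (hm : 0 < m) (r j : ℕ) {τ : ℍ} (hτ : τ.re = 0) :
    iteratedDeriv (2 * j) (thetaJ m r τ) 0 =
      (4 * π * Complex.I * m) ^ (2 * j) * thetaMoment (r / (2 * m)) j (2 * m * τ.im) := by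
  have hτ' : (τ : ℂ) = τ.im * Complex.I := Complex.ext (by simpa using hτ) (by simp)
  rw [← (hasSum_iteratedDeriv_of_hasSum_exp isOpen_univ (fun z _ => hasSum_thetaJ hm r τ z)
    (2 * j) 0 (Set.mem_univ _)).tsum_eq, thetaMoment, Complex.ofReal_tsum, ← tsum_mul_left]
  refine tsum_congr fun n => ?_
  have hexp : 2 * π * Complex.I * m * ((n : ℂ) + r / (2 * m)) ^ 2 * τ =
      ((-π * (n + r / (2 * m)) ^ 2 * (2 * m * τ.im) : ℝ) : ℂ) := by
    rw [hτ']
    push_cast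
    linear_combination (2 * π * m * ((n : ℂ) + r / (2 * m)) ^ 2 * τ.im) * Complex.I_sq
  rw [hexp, mul_zero, Complex.exp_zero, mul_pow (4 * π * Complex.I * m : ℂ),
    Complex.ofReal_mul (_ ^ _), Complex.ofReal_exp]
  push_cast
  ring

/-- The determinant `θ_{m,0} ∂²θ_{m,m}/∂z² - θ_{m,m} ∂²θ_{m,0}/∂z²` at `z = 0`. By the heat equation
it is a constant multiple of the Wronskian in `τ` of the two theta constants. -/
noncomputable def thetaWronskian (m : ℕ) (τ : ℍ) : ℂ :=
  thetaJ m 0 τ 0 * iteratedDeriv 2 (thetaJ m m τ) 0 -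
    thetaJ m m τ 0 * iteratedDeriv 2 (thetaJ m 0 τ) 0

lemma thetaWronskian_of_re_eq_zero (hm : 0 < m) {τ : ℍ} (hτ : τ.re = 0) :
    thetaWronskian m τ = (4 * π * Complex.I * m) ^ 2 *
      (thetaMoment 0 0 (2 * m * τ.im) * thetaMoment (1 / 2) 1 (2 * m * τ.im) -
        thetaMoment (1 / 2) 0 (2 * m * τ.im) * thetaMoment 0 1 (2 * m * τ.im) : ℝ) := by
  have hhalf : (m : ℝ) / (2 * m) = 1 / 2 := by
    rw [div_mul_cancel_right₀ (Nat.cast_ne_zero.2 hm.ne'), one_div]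
  have hθ (r : ℕ) := iteratedDeriv_thetaJ_zero hm r 0 hτ
  have hθ' (r : ℕ) := iteratedDeriv_thetaJ_zero hm r 1 hτ
  simp only [mul_zero, iteratedDeriv_zero, pow_zero, one_mul, mul_one] at hθ hθ'
  rw [thetaWronskian, hθ, hθ, hθ', hθ', hhalf, Nat.cast_zero, zero_div]
  push_cast
  ring

lemma exists_forall_thetaWronskian_ne_zero (hm : 0 < m) :
    ∃ Y : ℝ, ∀ τ : ℍ, τ.re = 0 → Y < τ.im → thetaWronskian m τ ≠ 0 := by
  obtain ⟨T, hT⟩ := eventually_atTop.1 eventually_thetaMoment_det_pos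
  have hm' : (0 : ℝ) < 2 * m := by positivity
  refine ⟨T / (2 * m), fun τ hre him => ?_⟩
  have hdet := hT (2 * m * τ.im) ((div_lt_iff₀' hm').1 him).le
  rw [thetaWronskian_of_re_eq_zero hm hre]
  exact mul_ne_zero (by simp [Real.pi_ne_zero, hm.ne']) (Complex.ofReal_ne_zero.2 hdet.ne')

lemma eq_zero_of_eq_thetaJ_add_thetaJ (hm : 0 < m) {τ : ℍ} (hW : thetaWronskian m τ ≠ 0) {a b : ℂ}
    {g : ℂ → ℂ} (hg : g = a • thetaJ m 0 τ + b • thetaJ m m τ) (h₀ : g 0 = 0)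
    (h₂ : iteratedDeriv 2 g 0 = 0) : g = 0 := by
  have hθ (r : ℕ) (a : ℂ) : ContDiffAt ℂ 2 (a • thetaJ m r τ) 0 :=
    ((differentiable_thetaJ hm r τ).const_smul a).contDiff.contDiffAt
  rw [hg, iteratedDeriv_add (hθ 0 a) (hθ m b), iteratedDeriv_const_smul_field,
    iteratedDeriv_const_smul_field] at h₂
  rw [hg] at h₀
  simp only [Pi.add_apply, Pi.smul_apply, smul_eq_mul] at h₀ h₂
  have ha : a = 0 := by
    refine (mul_eq_zero.1 ?_).resolve_right hW
    rw [thetaWronskian]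
    linear_combination iteratedDeriv 2 (thetaJ m m τ) 0 * h₀ - thetaJ m m τ 0 * h₂
  have hb : b = 0 := by
    refine (mul_eq_zero.1 ?_).resolve_right hW
    rw [thetaWronskian]
    linear_combination thetaJ m 0 τ 0 * h₂ - iteratedDeriv 2 (thetaJ m 0 τ) 0 * h₀
  rw [hg, ha, hb, zero_smul, zero_smul, add_zero]

end Theta

/-! ### The map `D₀ ⊕ D₂` -/

lemma eq_zero_of_eq_zero_on_imaginary_axis {f : ℍ → ℂ} (hf : MDiff f) {Y : ℝ}
    (hzero : ∀ τ : ℍ, τ.re = 0 → Y < τ.im → f τ = 0) : f = 0 := by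
  obtain ⟨y, hYy, hy⟩ : ∃ y, Y < y ∧ 0 < y :=
    (exists_gt (max Y 0)).imp fun _ => max_lt_iff.1
  have hcoe {t : ℝ} (ht : 0 < t) : (ofComplex (Complex.I * t) : ℂ) = Complex.I * t := by
    rw [ofComplex_apply_of_im_pos (by simpa using ht)]
  have hpos : ∀ᶠ t in 𝓝[≠] y, Y < t ∧ 0 < t :=
    nhdsWithin_le_nhds ((eventually_gt_nhds hYy).and (eventually_gt_nhds hy))
  have htendsto : Tendsto (fun t : ℝ => ofComplex (Complex.I * t)) (𝓝[≠] y)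
      (𝓝[≠] (ofComplex (Complex.I * y))) := by
    refine tendsto_nhdsWithin_iff.2 ⟨(continuousOn_ofComplex_I_mul.continuousAt
      (Ioi_mem_nhds hy)).tendsto.mono_left nhdsWithin_le_nhds, ?_⟩
    filter_upwards [hpos, self_mem_nhdsWithin] with t ht hne heq
    refine hne (Complex.ofReal_injective (mul_left_cancel₀ Complex.I_ne_zero ?_))
    rw [← hcoe ht.2, ← hcoe hy, heq]
  refine eq_zero_of_frequently hf (htendsto.frequently (Eventually.frequently ?_))
  filter_upwards [hpos] with t ht
  refine hzero _ ?_ ?_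
  · rw [← coe_re, hcoe ht.2]; simp
  · rw [← coe_im, hcoe ht.2]; simpa using ht.1

section Main

variable {k : ℤ} {m M : ℕ} {φ : ℍ → ℂ → ℂ}

namespace IsJacobiForm

lemma differentiableAt (h : IsJacobiForm k m M φ) (τ : ℍ) (z : ℂ) :
    DifferentiableAt ℂ (fun p : ℂ × ℂ => φ (ofComplex p.1) p.2) (τ, z) :=
  h.holo.differentiableAt
    ((isOpen_upperHalfPlaneSet.preimage continuous_fst).mem_nhds (x := ((τ : ℂ), z)) τ.im_pos)

lemma differentiable_right (h : IsJacobiForm k m M φ) (τ : ℍ) : Differentiable ℂ (φ τ) := by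
  intro z
  simpa only [Function.comp_def, ofComplex_apply] using
    (h.differentiableAt τ z).comp z ((differentiableAt_const (τ : ℂ)).prodMk differentiableAt_id)

lemma mdifferentiable_left (h : IsJacobiForm k m M φ) (z : ℂ) : MDiff fun τ => φ τ z :=
  mdifferentiable_iff.2 fun w hw =>
    ((h.differentiableAt ⟨w, hw⟩ z).comp (f := fun w : ℂ => (w, z)) w
      (differentiableAt_id.prodMk (differentiableAt_const z))).differentiableWithinAt

lemma exists_hasJacobiExpansion (h : IsJacobiForm k m M φ) (γ : SL(2, ℤ)) :
    ∃ c, HasJacobiExpansion m M (jacobiSlash k m γ φ) c :=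
  (h.fourier γ).imp fun _ hc => ⟨hc.1, hc.2⟩

lemma jacobiSlash_eq (h : IsJacobiForm k m M φ) {γ : SL(2, ℤ)}
    (hγ : γ ∈ CongruenceSubgroup.Gamma0 M) : jacobiSlash k m γ φ = φ :=
  funext₂ (h.slash γ hγ)

lemma jacobiD2_slash (h : IsJacobiForm k m M φ) (γ : SL(2, ℤ)) :
    jacobiD2 k m φ ∣[k + 2] γ = jacobiD2 k m (jacobiSlash k m γ φ) :=
  (jacobiD2_jacobiSlash h.differentiable_right (h.mdifferentiable_left 0) γ).symm

lemma mdifferentiable_jacobiD2 (h : IsJacobiForm k m M φ) : MDiff (jacobiD2 k m φ) := by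
  obtain ⟨c, hc⟩ := h.exists_hasJacobiExpansion 1
  simpa only [h.jacobiSlash_eq (one_mem _)] using hc.mdifferentiable_jacobiD2 k

end IsJacobiForm

/-- The operator `D₀`, as a linear map from Jacobi forms on `Γ₀(M)` to modular forms. -/
noncomputable def modularFormD0 (hm : 0 < m) (hM : 0 < M) :
    jacobiForms k m M →ₗ[ℂ] ModularForm (CongruenceSubgroup.Gamma0 M) k where
  toFun φ :=
    { toFun := jacobiD0 φ.1
      slash_action_eq' := by
        rintro _ ⟨γ, hγ, rfl⟩
        exact (jacobiD0_jacobiSlash k m γ φ.1).symm.trans (congrArg _ (φ.2.jacobiSlash_eq hγ))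
      holo' := φ.2.mdifferentiable_left 0
      bdd_at_cusps' := by
        intro c hc
        have : NeZero M := ⟨hM.ne'⟩
        rw [Subgroup.IsArithmetic.isCusp_iff_isCusp_SL2Z] at hc
        refine (OnePoint.isBoundedAt_iff_forall_SL2Z hc).2 fun γ _ => ?_
        obtain ⟨_, hexp⟩ := φ.2.exists_hasJacobiExpansion γ
        exact jacobiD0_jacobiSlash k m γ φ.1 ▸ hexp.isBoundedAtImInfty_jacobiD0 hm hM }
  map_add' _ _ := rfl
  map_smul' _ _ := rfl

/-- The operator `D₂`, as a linear map from Jacobi forms on `Γ₀(M)` to cusp forms. -/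
noncomputable def cuspFormD2 (hm : 0 < m) (hM : 0 < M) :
    jacobiForms k m M →ₗ[ℂ] CuspForm (CongruenceSubgroup.Gamma0 M) (k + 2) where
  toFun φ :=
    { toFun := jacobiD2 k m φ.1
      slash_action_eq' := by
        rintro _ ⟨γ, hγ, rfl⟩
        exact (φ.2.jacobiD2_slash γ).trans (congrArg _ (φ.2.jacobiSlash_eq hγ))
      holo' := φ.2.mdifferentiable_jacobiD2
      zero_at_cusps' := by
        intro c hc
        have : NeZero M := ⟨hM.ne'⟩
        rw [Subgroup.IsArithmetic.isCusp_iff_isCusp_SL2Z] at hc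
        refine (OnePoint.isZeroAt_iff_forall_SL2Z hc).2 fun γ _ => ?_
        obtain ⟨_, hexp⟩ := φ.2.exists_hasJacobiExpansion γ
        exact φ.2.jacobiD2_slash γ ▸ hexp.isZeroAtImInfty_jacobiD2 k hm hM }
  map_add' φ ψ := DFunLike.coe_injective <|
    jacobiD2_add φ.2.differentiable_right ψ.2.differentiable_right
      (φ.2.mdifferentiable_left 0) (ψ.2.mdifferentiable_left 0)
  map_smul' a φ := DFunLike.coe_injective (jacobiD2_smul a φ.1)

lemma jacobiFormsStar_le (k : ℤ) (m M : ℕ) : jacobiFormsStar k m M ≤ jacobiForms k m M :=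
  fun _ hφ => hφ.1

lemma exists_eq_thetaJ_add_thetaJ_of_mem_jacobiFormsStar (hm : 0 < m)
    (hφ : φ ∈ jacobiFormsStar k m M) (τ : ℍ) :
    ∃ a b : ℂ, φ τ = a • thetaJ m 0 τ + b • thetaJ m m τ := by
  obtain ⟨-, h, hdec, hstar⟩ := hφ
  refine ⟨h 0 τ, h m τ, funext fun z => (hdec τ z).trans ?_⟩
  refine Finset.sum_eq_add_of_mem _ _ (by simp [hm]) (by simp; omega) hm.ne fun r hr hne => ?_
  rw [hstar r (Finset.mem_range.1 hr) hne.1 hne.2, Pi.zero_apply, zero_mul]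

lemma iteratedDeriv_two_eq_zero_of_jacobiD2_eq_zero (hk : k ≠ 0) (h₀ : jacobiD0 φ = 0)
    (h₂ : jacobiD2 k m φ = 0) (τ : ℍ) : iteratedDeriv 2 (φ τ) 0 = 0 := by
  have hconst : (fun w => φ (ofComplex w) 0) = 0 := funext fun w => congrFun h₀ (ofComplex w)
  simpa [jacobiD2, hconst, hk, Real.pi_ne_zero] using congrFun h₂ τ

lemma eq_zero_of_jacobiD0_eq_zero_of_jacobiD2_eq_zero (hk : k ≠ 0) (hm : 0 < m)
    (hφ : φ ∈ jacobiFormsStar k m M) (h₀ : jacobiD0 φ = 0) (h₂ : jacobiD2 k m φ = 0) : φ = 0 := by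
  obtain ⟨Y, hY⟩ := exists_forall_thetaWronskian_ne_zero hm
  have haxis (τ : ℍ) (hre : τ.re = 0) (him : Y < τ.im) : φ τ = 0 := by
    obtain ⟨a, b, hab⟩ := exists_eq_thetaJ_add_thetaJ_of_mem_jacobiFormsStar hm hφ τ
    exact eq_zero_of_eq_thetaJ_add_thetaJ hm (hY τ hre him) hab (congrFun h₀ τ)
      (iteratedDeriv_two_eq_zero_of_jacobiD2_eq_zero hk h₀ h₂ τ)
  funext τ z
  have hφz : MDiff fun τ => φ τ z := IsJacobiForm.mdifferentiable_left hφ.1 z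
  exact congrFun (eq_zero_of_eq_zero_on_imaginary_axis hφz
    fun σ hre him => congrFun (haxis σ hre him) z) τ

end Main

theorem corollary4p3_general {k : ℤ} {m M : ℕ} (hk : k ≠ 0) (hm : 0 < m) (hM : 0 < M) :
    ∃ D : jacobiForms k m M →ₗ[ℂ]
        ModularForm (CongruenceSubgroup.Gamma0 M) k ×
          CuspForm (CongruenceSubgroup.Gamma0 M) (k + 2),
      (∀ (φ : jacobiForms k m M) (τ : ℍ), (D φ).1 τ = jacobiD0 φ.1 τ) ∧
      (∀ (φ : jacobiForms k m M) (τ : ℍ), (D φ).2 τ = jacobiD2 k m φ.1 τ) ∧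
      Function.Injective (D ∘ₗ Submodule.inclusion (jacobiFormsStar_le k m M)) := by
  refine ⟨(modularFormD0 hm hM).prod (cuspFormD2 hm hM), fun _ _ => rfl, fun _ _ => rfl,
    (injective_iff_map_eq_zero _).2 fun φ hφ => Subtype.ext ?_⟩
  exact eq_zero_of_jacobiD0_eq_zero_of_jacobiD2_eq_zero hk hm φ.2
    (congrArg (fun F => (F.1 : ℍ → ℂ)) hφ) (congrArg (fun F => (F.2 : ℍ → ℂ)) hφ)

/-- `D₀ ⊕ D₂` is a well-defined linear map
`J*_{k,m}(Γ₀(mN)) → M_k(Γ₀(mN)) ⊕ S_{k+2}(Γ₀(mN))`, and it is injective. -/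
theorem corollary4p3 (k : ℤ) (m N : ℕ) (hk : 0 < k) (hm : Squarefree m) (hN : 0 < N) :
    ∃ D : jacobiFormsStar k m (m * N) →ₗ[ℂ]
        ModularForm (CongruenceSubgroup.Gamma0 (m * N)) k ×
          CuspForm (CongruenceSubgroup.Gamma0 (m * N)) (k + 2),
      (∀ (φ : jacobiFormsStar k m (m * N)) (τ : ℍ), (D φ).1 τ = jacobiD0 φ.1 τ) ∧
      (∀ (φ : jacobiFormsStar k m (m * N)) (τ : ℍ), (D φ).2 τ = jacobiD2 k m φ.1 τ) ∧
      Function.Injective D := by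
  have hm₀ : 0 < m := Nat.pos_of_ne_zero hm.ne_zero
  obtain ⟨D, h₀, h₂, hinj⟩ := corollary4p3_general (m := m) hk.ne' hm₀ (Nat.mul_pos hm₀ hN)
  exact ⟨D ∘ₗ Submodule.inclusion (jacobiFormsStar_le k m (m * N)),
    fun _ => h₀ _, fun _ => h₂ _, hinj⟩
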